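/- Let $K\ge 1$, $\epsilon>0$, $\kappa\in(0,1)$, $[K]=\{1,\dots,K\}$, and let $\Delta=\{\theta\in\mathbb R^K:\ \theta_k\ge 0,\ \sum_k\theta_k=1\}$ with the Euclidean norm; $\mathrm d\theta$ denotes Lebesgue measure in the coordinates $(\theta_1,\dots,\theta_{K-1})$ restricted to $\Delta$. *Mechanism.* For $x\in A\subseteq[K]$ let $\mathrm{SRR}(x;A,e)$ equal $x$ with probability $e^{e}/(e^{e}+|A|-1)$ and otherwise be uniform on $A\setminus\{x\}$. For $S\subsetneq[K]$ with complement $S^c$, put $\epsilon_1=\kappa\epsilon$, and $\epsilon_2=\min\{\epsilon,\ln\frac{|S^c|-1}{e^{\epsilon_1-\epsilon}|S^c|-1}\}$ if $S\neq\emptyset$ and $\epsilon-\epsilon_1<\ln|S^c|$, $\epsilon_2=\epsilon$ otherwise. The response $\mathrm{RRRR}(x;S,\epsilon)$ is $\mathrm{SRR}(x;S\cup\{R\},\epsilon_1)$ with $R$ uniform on $S^c$ if $x\in S$, and $\mathrm{SRR}(R;S\cup\{R\},\epsilon_1)$ with $R=\mathrm{SRR}(x;S^c,\epsilon_2)$ if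 $x\notin S$. Let $g_{S,\epsilon}(y\mid x)$ be the probability that $\mathrm{RRRR}(x;S,\epsilon)=y$, and $h_{S,\epsilon}(y\mid\theta)=\sum_{x}g_{S,\epsilon}(y\mid x)\theta_x$. *Subset selection.* Let $U(\theta,S,\epsilon)\in\mathbb R$ be any utility function. For $\theta\in\Delta$ let $\sigma_\theta$ be a permutation with $\theta_{\sigma_\theta(1)}\ge\dots\ge\theta_{\sigma_\theta(K)}$, and let $S^*_\theta=\{\sigma_\theta(1),\dots,\sigma_\theta(k)\}$, where $k$ maximizes $U(\theta,\{\sigma_\theta(1),\dots,\sigma_\theta(k)\},\epsilon)$ over $k\in\{0,\dots,K-1\}$; ties are broken in any way that makes $\theta\mapsto S^*_\theta$ measurable. *Algorithm.* Let $\theta^*,\theta_{\mathrm{init}}\in\Delta$, and let $Q$ be any family of Markov kernels $Q(\cdot\mid Y_{1:n},S_{1:n},\Theta_{n-1})$ on $\Delta$, $n\ge1$. Let $P_{\theta^*}$ be the law of the sequence given by $\Theta_0=\theta_{\mathrm{init}}$ and, for $t\ge 1$: $S_t=S^*_{\Theta_{t-1}}$; given the past, $Y_t=\mathrm{RRRR}(X_t;S_t,\epsilon)$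 with $X_t\sim\mathrm{Cat}(\theta^*)$ drawn independently of the past, so that $Y_t$ has probabilities $h_{S_t,\epsilon}(\cdot\mid\theta^*)$; and $\Theta_t\sim Q(\cdot\mid Y_{1:t},S_{1:t},\Theta_{t-1})$. *Posterior.* For a probability density $\eta$ on $\Delta$ with respect to $\mathrm d\theta$ and measurable $A\subseteq\Delta$ let $$\Pi(A\mid Y_{1:n},S_{1:n})=\frac{\int_A\eta(\theta)\prod_{t=1}^n h_{S_t,\epsilon}(Y_t\mid\theta)\,\mathrm d\theta}{\int_\Delta\eta(\theta)\prod_{t=1}^n h_{S_t,\epsilon}(Y_t\mid\theta)\,\mathrm d\theta}.$$ **Theorem.** There is a constant $c>0$, depending only on $K,\epsilon,\kappa$, such that the following holds for all $\theta^*,\theta_{\mathrm{init}}\in\Delta$, all utility functions $U$ and selections $S^*_\theta$ as above, all kernels $Q$, and all prior densities $\eta$ for which there are $d,B>0$ such that $\eta(\theta')>0$ and $\eta(\theta)/\eta(\theta')<B$ for all $\theta,\theta'\in\Delta$ with $\|\theta'-\theta^*\|<d$. For every $a\in(0,1)$, with $\Omega_n=\{\theta\in\Delta:\|\theta-\theta^*\|^2\le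 c\,n^{-a}\}$, $$\Pi(\Omega_n\mid Y_{1:n},S_{1:n})\longrightarrow 1\quad\text{in } P_{\theta^*}\text{-probability as } n\to\infty.$$ -/

import Mathlib

open MeasureTheory ProbabilityTheory Filter

noncomputable section

namespace AdOBEst

/-- The probability simplex `Δ` of probability vectors over `K = N + 1` categories, as a subspace
of Euclidean space. The category set `[K]` is `Fin (N + 1)`. -/
abbrev Simplex (N : ℕ) : Type :=
  {θ : EuclideanSpace ℝ (Fin (N + 1)) // (∑ k, θ k = 1) ∧ ∀ k, 0 ≤ θ k}

/-- The proper subsets `S ⊂ [K]`. -/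
abbrev ProperSubset (N : ℕ) : Type :=
  {S : Finset (Fin (N + 1)) // S ≠ Finset.univ}

theorem compl_nonempty {N : ℕ} (S : ProperSubset N) : (S.1ᶜ).Nonempty := by
  rw [Finset.nonempty_iff_ne_empty]
  intro h
  exact S.2 (by simpa using h)

/-- The first `K - 1` coordinates `ϑ` of a probability vector `θ`. -/
def freeCoords {N : ℕ} (θ : Simplex N) : Fin N → ℝ := fun i => θ.1 i.castSucc

/-- The reference measure `dθ` on `Δ`: Lebesgue measure of the free coordinates `ϑ`. -/
def lebesgueSimplex (N : ℕ) : Measure (Simplex N) :=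
  Measure.comap freeCoords volume

/-! ### The randomized response mechanisms -/

/-- A coin that shows `true` with probability `p / (p + m)`. -/
def coin (p : ℝ) (hp : 0 < p) (m : ℕ) : PMF Bool :=
  PMF.ofFintype
    (fun b => cond b (ENNReal.ofReal (p / (p + m))) (ENNReal.ofReal (1 - p / (p + m)))) (by
      have h0 : (0 : ℝ) ≤ m := Nat.cast_nonneg m
      have h1 : p / (p + m) ≤ 1 := (div_le_one (by linarith)).2 (by linarith)
      have h2 : 0 ≤ p / (p + m) := div_nonneg hp.le (by linarith)
      simp only [Fintype.sum_bool, cond_true, cond_false]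
      rw [← ENNReal.ofReal_add h2 (by linarith)]
      simp)

/-- Standard randomized response `SRR(x; A, e)` on the set `A` (with `x ∈ A`): the output is `x`
with probability `exp e / (exp e + |A| - 1)`, and otherwise is uniform on `A \ {x}`. If
`A \ {x}` is empty, the second case has probability zero. -/
def srr {N : ℕ} (A : Finset (Fin (N + 1))) (e : ℝ) (x : Fin (N + 1)) : PMF (Fin (N + 1)) :=
  (coin (Real.exp e) (Real.exp_pos e) (A.card - 1)).bind fun honest =>
    if honest then PMF.pure x
    else if hA : (A.erase x).Nonempty then PMF.uniformOfFinset (A.erase x) hA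
    else PMF.pure x

/-- The randomly restricted randomized response mechanism with subset `S` and privacy parameters
`e₁`, `e₂`, on input `x`. -/
def rrrr {N : ℕ} (S : ProperSubset N) (e₁ e₂ : ℝ) (x : Fin (N + 1)) : PMF (Fin (N + 1)) :=
  if x ∈ S.1 then
    (PMF.uniformOfFinset S.1ᶜ (compl_nonempty S)).bind fun r => srr (insert r S.1) e₁ x
  else
    (srr S.1ᶜ e₂ x).bind fun r => srr (insert r S.1) e₁ r

/-- The second privacy parameter `ε₂`, as a function of `ε`, `ε₁` and `S`. -/
def eps₂ {N : ℕ} (ε ε₁ : ℝ) (S : ProperSubset N) : ℝ :=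
  if ε - ε₁ < Real.log ((S.1ᶜ).card : ℝ) ∧ 0 < S.1.card then
    min ε (Real.log ((((S.1ᶜ).card : ℝ) - 1) / (Real.exp (ε₁ - ε) * ((S.1ᶜ).card : ℝ) - 1)))
  else ε

/-- `RRRR(x; S, ε)`: the mechanism with `ε₁ = κ ε` and the corresponding `ε₂`. -/
def mechanism {N : ℕ} (ε κ : ℝ) (S : ProperSubset N) (x : Fin (N + 1)) : PMF (Fin (N + 1)) :=
  rrrr S (κ * ε) (eps₂ ε (κ * ε) S) x

/-- `g_{S,ε}(y | x)`, the probability of the response `y` on input `x`. -/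
def g {N : ℕ} (ε κ : ℝ) (S : ProperSubset N) (y x : Fin (N + 1)) : ℝ :=
  (mechanism ε κ S x y).toReal

/-- `h_{S,ε}(y | θ) = ∑ₓ g_{S,ε}(y | x) θₓ`. -/
def h {N : ℕ} (ε κ : ℝ) (S : ProperSubset N) (y : Fin (N + 1)) (θ : Simplex N) : ℝ :=
  ∑ x, g ε κ S y x * θ.1 x

/-- The categorical distribution `Cat(θ)`. -/
def cat {N : ℕ} (θ : Simplex N) : PMF (Fin (N + 1)) :=
  PMF.ofFintype (fun k => ENNReal.ofReal (θ.1 k)) (by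
    rw [← ENNReal.ofReal_sum_of_nonneg fun k _ => θ.2.2 k, θ.2.1, ENNReal.ofReal_one])

/-- The law of `Y = RRRR(X; S, ε)` when `X ∼ Cat(θ)`. -/
def responseLaw {N : ℕ} (ε κ : ℝ) (θ : Simplex N) (S : ProperSubset N) : PMF (Fin (N + 1)) :=
  (cat θ).bind fun x => mechanism ε κ S x

/-! ### Subset selection -/

/-- `{σ(1), …, σ(k)}`, for `k ∈ {0, …, K - 1}`. -/
def topSubset {N : ℕ} (σ : Equiv.Perm (Fin (N + 1))) (k : Fin (N + 1)) : ProperSubset N :=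
  ⟨(Finset.univ.filter fun i => i < k).image σ, by
    intro hu
    have hm : σ k ∈ (Finset.univ.filter fun i => i < k).image σ := by
      rw [hu]; exact Finset.mem_univ _
    simp at hm⟩

/-- `sel θ` is a best subset `S*_θ` for the utility `U`, for every `θ`: it consists of the `k`
categories of largest probability, in an order `σ` in which the entries of `θ` are non-increasing,
where `k` maximizes the utility of such subsets over `{0, …, K - 1}`. Ties are broken
arbitrarily. -/
def IsBestSubsetRule {N : ℕ} (U : Simplex N → ProperSubset N → ℝ → ℝ) (ε : ℝ)
    (sel : Simplex N → ProperSubset N) : Prop :=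
  ∀ θ : Simplex N, ∃ σ : Equiv.Perm (Fin (N + 1)), ∃ k : Fin (N + 1),
    (∀ i j, i ≤ j → θ.1 (σ j) ≤ θ.1 (σ i)) ∧
    (∀ j, U θ (topSubset σ j) ε ≤ U θ (topSubset σ k) ε) ∧
    sel θ = topSubset σ k

/-! ### The prior and the posterior -/

/-- `η` is a probability density on `Δ` with respect to `dθ`. -/
structure IsPriorDensity {N : ℕ} (η : Simplex N → ℝ) : Prop where
  measurable : Measurable η
  nonneg : ∀ θ, 0 ≤ η θ
  integral_eq_one : ∫ θ, η θ ∂(lebesgueSimplex N) = 1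

/-- The prior density ratio `η(θ) / η(θ')` is bounded for `θ'` near `θstar`. That the ratio is
meaningful, i.e. `η(θ') > 0`, is part of the condition. -/
def PriorRatioBounded {N : ℕ} (η : Simplex N → ℝ) (θstar : Simplex N) : Prop :=
  ∃ d > 0, ∃ B > 0, ∀ θ θ' : Simplex N, ‖θ'.1 - θstar.1‖ < d → 0 < η θ' ∧ η θ / η θ' < B

/-- Data `(S₁, Y₁), …, (Sₙ, Yₙ)`. -/
abbrev Data (N n : ℕ) : Type := Fin n → ProperSubset N × Fin (N + 1)

/-- The posterior probability `Π(A | Y_{1:n}, S_{1:n})`. -/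
def posterior {N : ℕ} (ε κ : ℝ) (η : Simplex N → ℝ) {n : ℕ} (D : Data N n)
    (A : Set (Simplex N)) : ℝ :=
  (∫ θ in A, η θ * ∏ t, h ε κ (D t).1 (D t).2 θ ∂(lebesgueSimplex N)) /
    (∫ θ, η θ * ∏ t, h ε κ (D t).1 (D t).2 θ ∂(lebesgueSimplex N))

/-! ### The law of the algorithm -/

/-- The record `(Θ_t, S_{t+1}, Y_{t+1})`, for `t = 0, 1, 2, …`. -/
abbrev Record (N : ℕ) : Type := Simplex N × ProperSubset N × Fin (N + 1)

/-- The data `(S₁, Y₁), …, (Sₙ, Yₙ)` of a trajectory of records. -/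
def data {N : ℕ} (n : ℕ) (ω : ℕ → Record N) : Data N n := fun i => (ω i).2

/-- The data `(S₁, Y₁), …, (S_{n+1}, Y_{n+1})` and the sample `Θ_n` contained in the records
at times `0, …, n`. -/
def history {N : ℕ} (n : ℕ) (r : (i : Finset.Iic n) → Record N) : Data N (n + 1) × Simplex N :=
  (fun i => (r ⟨i, Finset.mem_Iic.2 (Nat.lt_succ_iff.1 i.2)⟩).2,
    (r ⟨n, Finset.mem_Iic.2 le_rfl⟩).1)

theorem measurable_history {N : ℕ} (n : ℕ) : Measurable (history (N := N) n) := by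
  unfold history
  fun_prop

/-- Given `Θ_t = θ`, set `S_{t+1} = sel θ` and draw `Y_{t+1} = RRRR(X; S_{t+1}, ε)` with
`X ∼ Cat(θstar)`. -/
def observe {N : ℕ} (ε κ : ℝ) (θstar : Simplex N) (sel : Simplex N → ProperSubset N)
    (hsel : Measurable sel) : Kernel (Simplex N) (Record N) :=
  Kernel.deterministic id measurable_id ×ₖ
    ((Kernel.deterministic sel hsel) ⊗ₖ
      Kernel.prodMkLeft (Simplex N)
        (Kernel.ofFunOfCountable fun S => (responseLaw ε κ θstar S).toMeasure))

instance {N : ℕ} (ε κ : ℝ) (θstar : Simplex N) (sel : Simplex N → ProperSubset N)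
    (hsel : Measurable sel) : IsMarkovKernel (observe ε κ θstar sel hsel) := by
  have : IsMarkovKernel (Kernel.ofFunOfCountable fun S : ProperSubset N =>
      (responseLaw ε κ θstar S).toMeasure) := ⟨fun S => by
    change IsProbabilityMeasure (responseLaw ε κ θstar S).toMeasure
    infer_instance⟩
  unfold observe
  infer_instance

/-- One step of the algorithm: draw
`Θ_{n+1} ∼ Q(· | Y_{1:n+1}, S_{1:n+1}, Θ_n)`, then generate `S_{n+2}` and `Y_{n+2}`. -/
def step {N : ℕ} (ε κ : ℝ) (θstar : Simplex N) (sel : Simplex N → ProperSubset N)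
    (hsel : Measurable sel) (Q : (n : ℕ) → Kernel (Data N n × Simplex N) (Simplex N)) (n : ℕ) :
    Kernel ((i : Finset.Iic n) → Record N) (Record N) :=
  observe ε κ θstar sel hsel ∘ₖ (Q (n + 1)).comap (history n) (measurable_history n)

instance {N : ℕ} (ε κ : ℝ) (θstar : Simplex N) (sel : Simplex N → ProperSubset N)
    (hsel : Measurable sel) (Q : (n : ℕ) → Kernel (Data N n × Simplex N) (Simplex N))
    [∀ n, IsMarkovKernel (Q n)] (n : ℕ) : IsMarkovKernel (step ε κ θstar sel hsel Q n) := by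
  unfold step
  infer_instance

/-- The law `P_{θ*}` of the trajectory `(Θ_t, S_{t+1}, Y_{t+1})`, `t ≥ 0`, of the algorithm started
at `Θ₀ = θinit`, with the posterior sampling kernels `Q n`, `n ≥ 1`. -/
def law {N : ℕ} (ε κ : ℝ) (θstar θinit : Simplex N) (sel : Simplex N → ProperSubset N)
    (hsel : Measurable sel) (Q : (n : ℕ) → Kernel (Data N n × Simplex N) (Simplex N))
    [∀ n, IsMarkovKernel (Q n)] : Measure (ℕ → Record N) :=
  Kernel.trajMeasure (X := fun _ => Record N) (observe ε κ θstar sel hsel θinit)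
    (step ε κ θstar sel hsel Q)

end AdOBEst

end

/-!
For every proper subset `S`, the response probabilities determine `θ`: the matrix of `g` is
injective on vectors with zero sum. As there are finitely many `S`, the Hellinger affinity of the
response laws at `θ` and `θstar` is at most `1 - δ * ‖θ - θstar‖ ^ 2` for some `δ > 0` which does
not depend on `S`. Since this bound holds whatever subset is selected, the square root of the
likelihood ratio of `n` responses has mean at most `exp (-n * δ * ‖θ - θstar‖ ^ 2)`, however the
samples `Θ_t`, and hence the subsets, depend on the past.

The likelihood changes by at most a constant factor between points whose coordinates differ by at
most `1 / n`. Hence the likelihood ratio outside `Ω_n` is controlled by its values on a net of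
polynomial size, and a copy of the simplex shrunk towards `θstar` by the factor `1 / n` shows that
the evidence is at least polynomially small. Outside `Ω_n` the exponential bound is
`exp (-c * δ * n ^ (1 - a))`, which for `a < 1` beats every polynomial.
-/

namespace AdOBEst

/-! ### The response probabilities -/

theorem toReal_mem_stdSimplex {α : Type*} [Fintype α] (p : PMF α) :
    (fun a => (p a).toReal) ∈ stdSimplex ℝ α := by
  refine ⟨fun a => ENNReal.toReal_nonneg, ?_⟩
  have hsum : ∑ a, p a = 1 := by rw [← tsum_fintype (L := .unconditional _), p.tsum_coe]
  rw [← ENNReal.toReal_sum fun a _ => p.apply_ne_top a, hsum, ENNReal.toReal_one]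

theorem toReal_bind_apply {α β : Type*} [Fintype α] (p : PMF α) (f : α → PMF β) (b : β) :
    (p.bind f b).toReal = ∑ a, (p a).toReal * (f a b).toReal := by
  rw [PMF.bind_apply, tsum_fintype, ENNReal.toReal_sum fun a _ =>
    ENNReal.mul_ne_top (p.apply_ne_top a) ((f a).apply_ne_top b)]
  simp_rw [ENNReal.toReal_mul]

theorem toReal_uniformOfFinset_apply {α : Type*} [DecidableEq α] {s : Finset α} (hs : s.Nonempty)
    (a : α) : (PMF.uniformOfFinset s hs a).toReal = if a ∈ s then (s.card : ℝ)⁻¹ else 0 := by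
  rw [PMF.uniformOfFinset_apply]
  split_ifs <;> simp

theorem toReal_coin_true {p : ℝ} (hp : 0 < p) (m : ℕ) :
    (coin p hp m true).toReal = p / (p + m) := by
  simp only [coin, PMF.ofFintype_apply, cond_true]
  exact ENNReal.toReal_ofReal (by positivity)

theorem toReal_coin_false {p : ℝ} (hp : 0 < p) (m : ℕ) :
    (coin p hp m false).toReal = m / (p + m) := by
  have hcompl : 1 - p / (p + m) = m / (p + m) := by
    rw [one_sub_div (by positivity), add_sub_cancel_left]
  simp only [coin, PMF.ofFintype_apply, cond_false, hcompl]
  exact ENNReal.toReal_ofReal (by positivity)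

variable {N : ℕ}

theorem toReal_srr_apply {A : Finset (Fin (N + 1))} {x : Fin (N + 1)} (hx : x ∈ A) (e : ℝ)
    (y : Fin (N + 1)) :
    (srr A e x y).toReal =
      if y ∈ A then (if x = y then Real.exp e else 1) / (Real.exp e + (A.card - 1 : ℕ)) else 0 := by
  have hcard : (A.erase x).card = A.card - 1 := Finset.card_erase_of_mem hx
  rw [srr, toReal_bind_apply, Fintype.sum_bool, toReal_coin_true, toReal_coin_false]
  simp only [if_true, Bool.false_eq_true, if_false]
  by_cases hA : (A.erase x).Nonempty
  · rw [dif_pos hA, toReal_uniformOfFinset_apply]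
    have hpos : (0 : ℝ) < (A.card - 1 : ℕ) := by
      rw [← hcard]
      exact_mod_cast hA.card_pos
    rcases eq_or_ne x y with rfl | hxy
    · simp [hx]
    by_cases hy : y ∈ A
    · simp only [PMF.pure_apply, hxy.symm, if_false, Finset.mem_erase, ne_eq, not_false_eq_true,
        hy, and_self, if_true, hxy, hcard, ENNReal.toReal_zero]
      field_simp
      ring
    · simp [hxy.symm, hy]
  · have herase := Finset.not_nonempty_iff_eq_empty.1 hA
    have hm : A.card - 1 = 0 := by rw [← hcard, herase, Finset.card_empty]
    rcases eq_or_ne x y with rfl | hxy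
    · simp [hx, hm, hA]
    · have hy : y ∉ A := fun h => hA ⟨y, Finset.mem_erase.2 ⟨hxy.symm, h⟩⟩
      simp [hxy.symm, hy, hm, hA]

theorem card_compl_pos (S : ProperSubset N) : (0 : ℝ) < S.1ᶜ.card := by
  exact_mod_cast (compl_nonempty S).card_pos

theorem toReal_srr_insert_apply {S : Finset (Fin (N + 1))} {r x : Fin (N + 1)} (hr : r ∉ S)
    (hx : x ∈ insert r S) (e : ℝ) (y : Fin (N + 1)) :
    (srr (insert r S) e x y).toReal =
      if y ∈ insert r S then (if x = y then Real.exp e else 1) / (Real.exp e + S.card) else 0 := by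
  rw [toReal_srr_apply hx, Finset.card_insert_of_notMem hr, Nat.add_sub_cancel]

theorem g_eq_of_mem {S : ProperSubset N} {x : Fin (N + 1)} (hx : x ∈ S.1) (ε κ : ℝ)
    (y : Fin (N + 1)) :
    g ε κ S y x = if y ∈ S.1
      then (if x = y then Real.exp (κ * ε) else 1) / (Real.exp (κ * ε) + S.1.card)
      else (S.1ᶜ.card : ℝ)⁻¹ * (1 / (Real.exp (κ * ε) + S.1.card)) := by
  have hcard := card_compl_pos S
  have hsummand : ∀ r, (PMF.uniformOfFinset S.1ᶜ (compl_nonempty S) r).toReal *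
      (srr (insert r S.1) (κ * ε) x y).toReal = if r ∈ S.1ᶜ then (S.1ᶜ.card : ℝ)⁻¹ *
        (if y ∈ insert r S.1 then (if x = y then Real.exp (κ * ε) else 1) /
        (Real.exp (κ * ε) + S.1.card) else 0) else 0 := by
    intro r
    rw [toReal_uniformOfFinset_apply]
    by_cases hr : r ∈ S.1ᶜ
    · rw [if_pos hr, if_pos hr,
        toReal_srr_insert_apply (Finset.mem_compl.1 hr) (Finset.mem_insert_of_mem hx)]
    · rw [if_neg hr, if_neg hr, zero_mul]
  rw [g, mechanism, rrrr, if_pos hx, toReal_bind_apply]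
  simp_rw [hsummand]
  rw [← Finset.sum_filter, Finset.filter_univ_mem, ← Finset.mul_sum]
  by_cases hy : y ∈ S.1
  · simp only [Finset.mem_insert, hy, or_true, if_true, Finset.sum_const, nsmul_eq_mul]
    field_simp
  · have hxy : x ≠ y := fun h => hy (h ▸ hx)
    simp [hy, hxy, Finset.sum_ite_eq]

theorem g_eq_of_notMem {S : ProperSubset N} {x : Fin (N + 1)} (hx : x ∉ S.1) (ε κ : ℝ)
    (y : Fin (N + 1)) :
    g ε κ S y x = if y ∈ S.1 then 1 / (Real.exp (κ * ε) + S.1.card)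
      else (if x = y then Real.exp (eps₂ ε (κ * ε) S) else 1) /
        (Real.exp (eps₂ ε (κ * ε) S) + (S.1ᶜ.card - 1 : ℕ)) *
        (Real.exp (κ * ε) / (Real.exp (κ * ε) + S.1.card)) := by
  have hxc : x ∈ S.1ᶜ := Finset.mem_compl.2 hx
  rw [g, mechanism, rrrr, if_neg hx, toReal_bind_apply]
  set e₂ := eps₂ ε (κ * ε) S
  have hsummand : ∀ r, (srr S.1ᶜ e₂ x r).toReal * (srr (insert r S.1) (κ * ε) r y).toReal =
      (srr S.1ᶜ e₂ x r).toReal * if y ∈ S.1 then 1 / (Real.exp (κ * ε) + S.1.card)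
        else if r = y then Real.exp (κ * ε) / (Real.exp (κ * ε) + S.1.card) else 0 := by
    intro r
    by_cases hr : r ∈ S.1
    · rw [toReal_srr_apply hxc, if_neg (by simpa using hr), zero_mul, zero_mul]
    · rw [toReal_srr_insert_apply hr (Finset.mem_insert_self r S.1)]
      by_cases hy : y ∈ S.1
      · have hry : r ≠ y := fun h => hr (h ▸ hy)
        simp [hy, hry]
      · rcases eq_or_ne r y with rfl | hry
        · simp [hr]
        · simp [hy, hry, hry.symm]
  simp_rw [hsummand]
  by_cases hy : y ∈ S.1
  · simp only [hy, if_true]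
    rw [← Finset.sum_mul, (toReal_mem_stdSimplex _).2, one_mul]
  · simp only [hy, if_false, mul_ite, mul_zero, Finset.sum_ite_eq', Finset.mem_univ, if_true]
    rw [toReal_srr_apply hxc, if_pos (Finset.mem_compl.2 hy)]

theorem g_pos (ε κ : ℝ) (S : ProperSubset N) (y x : Fin (N + 1)) : 0 < g ε κ S y x := by
  have hcard := card_compl_pos S
  by_cases hx : x ∈ S.1
  · rw [g_eq_of_mem hx]
    split_ifs <;> positivity
  · rw [g_eq_of_notMem hx]
    split_ifs <;> positivity

theorem g_le_one (ε κ : ℝ) (S : ProperSubset N) (y x : Fin (N + 1)) : g ε κ S y x ≤ 1 :=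
  (mem_Icc_of_mem_stdSimplex (toReal_mem_stdSimplex (mechanism ε κ S x)) y).2

/-! ### Identifiability -/

theorem eps₂_ne_zero {ε ε₁ : ℝ} (hε : ε ≠ 0) (hlt : 0 < ε → ε₁ < ε) (S : ProperSubset N) :
    eps₂ ε ε₁ S ≠ 0 := by
  rcases hε.lt_or_gt with hneg | hpos
  · refine ne_of_lt (lt_of_le_of_lt ?_ hneg)
    unfold eps₂
    split_ifs
    exacts [min_le_left _ _, le_rfl]
  · unfold eps₂
    split_ifs with hS
    · refine (lt_min hpos (Real.log_pos ?_)).ne'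
      have hcard := card_compl_pos S
      have hexp : Real.exp (ε - ε₁) < S.1ᶜ.card := (Real.lt_log_iff_exp_lt hcard).1 hS.1
      have hden : 1 < Real.exp (ε₁ - ε) * S.1ᶜ.card := by
        calc (1 : ℝ) = Real.exp (ε₁ - ε) * Real.exp (ε - ε₁) := by rw [← Real.exp_add]; simp
          _ < _ := by gcongr
      have hlt_one : Real.exp (ε₁ - ε) < 1 := by simpa using hlt hpos
      rw [one_lt_div (by linarith)]
      nlinarith
    · exact hε

theorem sum_ite_mul_of_sum_eq_zero {ι : Type*} [Fintype ι] [DecidableEq ι] {v : ι → ℝ}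
    (hv : ∑ x, v x = 0) (p : ℝ) (y : ι) :
    ∑ x, (if x = y then p else 1) * v x = (p - 1) * v y := by
  have hsplit : ∀ x, (if x = y then p else 1) * v x = v x + if x = y then (p - 1) * v x else 0 := by
    intro x
    split_ifs <;> ring
  simp_rw [hsplit, Finset.sum_add_distrib, hv, Finset.sum_ite_eq', Finset.mem_univ, if_true,
    zero_add]

theorem sum_g_mul_of_mem {S : ProperSubset N} {y : Fin (N + 1)} (hy : y ∈ S.1) (ε κ : ℝ)
    {v : Fin (N + 1) → ℝ} (hv : ∑ x, v x = 0) :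
    ∑ x, g ε κ S y x * v x = (Real.exp (κ * ε) - 1) / (Real.exp (κ * ε) + S.1.card) * v y := by
  have hg : ∀ x, g ε κ S y x * v x =
      ((if x = y then Real.exp (κ * ε) else 1) * v x) / (Real.exp (κ * ε) + S.1.card) := by
    intro x
    by_cases hx : x ∈ S.1
    · rw [g_eq_of_mem hx, if_pos hy]
      ring
    · have hxy : x ≠ y := fun h => hx (h ▸ hy)
      rw [g_eq_of_notMem hx, if_pos hy, if_neg hxy]
      ring
  simp_rw [hg]
  rw [← Finset.sum_div, sum_ite_mul_of_sum_eq_zero hv]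
  ring

theorem sum_g_mul_of_notMem {S : ProperSubset N} {y : Fin (N + 1)} (hy : y ∉ S.1) (ε κ : ℝ)
    {v : Fin (N + 1) → ℝ} (hv : ∑ x, v x = 0) (hvS : ∀ x ∈ S.1, v x = 0) :
    ∑ x, g ε κ S y x * v x =
      (Real.exp (eps₂ ε (κ * ε) S) - 1) /
        (Real.exp (eps₂ ε (κ * ε) S) + (S.1ᶜ.card - 1 : ℕ)) *
        (Real.exp (κ * ε) / (Real.exp (κ * ε) + S.1.card)) * v y := by
  have hg : ∀ x, g ε κ S y x * v x =
      ((if x = y then Real.exp (eps₂ ε (κ * ε) S) else 1) * v x) *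
        (1 / (Real.exp (eps₂ ε (κ * ε) S) + (S.1ᶜ.card - 1 : ℕ)) *
          (Real.exp (κ * ε) / (Real.exp (κ * ε) + S.1.card))) := by
    intro x
    by_cases hx : x ∈ S.1
    · simp [hvS x hx]
    · rw [g_eq_of_notMem hx, if_neg hy]
      ring
  simp_rw [hg]
  rw [← Finset.sum_mul, sum_ite_mul_of_sum_eq_zero hv]
  ring

theorem eq_zero_of_sum_g_mul_eq_zero {ε κ : ℝ} (hε : ε ≠ 0) (hκ₀ : κ ≠ 0) (hκ₁ : κ < 1)
    (S : ProperSubset N) {v : Fin (N + 1) → ℝ} (hv : ∑ x, v x = 0)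
    (hgv : ∀ y, ∑ x, g ε κ S y x * v x = 0) : v = 0 := by
  have hexp : ∀ {e : ℝ}, e ≠ 0 → Real.exp e - 1 ≠ 0 := fun he =>
    sub_ne_zero.2 (mt (Real.exp_eq_one_iff _).1 he)
  have he₁ := hexp (mul_ne_zero hκ₀ hε)
  have he₂ := hexp (eps₂_ne_zero hε (ε₁ := κ * ε) (fun hpos => by nlinarith) S)
  have hvS : ∀ y ∈ S.1, v y = 0 := by
    intro y hy
    have hzero := hgv y
    rw [sum_g_mul_of_mem hy ε κ hv] at hzero
    exact (mul_eq_zero.1 hzero).resolve_left (div_ne_zero he₁ (by positivity))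
  funext y
  by_cases hy : y ∈ S.1
  · exact hvS y hy
  · have hzero := hgv y
    rw [sum_g_mul_of_notMem hy ε κ hv hvS] at hzero
    exact (mul_eq_zero.1 hzero).resolve_left
      (mul_ne_zero (div_ne_zero he₂ (by positivity)) (by positivity))

theorem h_sub_h (ε κ : ℝ) (S : ProperSubset N) (y : Fin (N + 1)) (θ θ' : Simplex N) :
    h ε κ S y θ - h ε κ S y θ' = ∑ x, g ε κ S y x * (θ.1 - θ'.1) x := by
  simp only [h, PiLp.sub_apply, mul_sub, Finset.sum_sub_distrib]

/-- The vectors with entries summing to zero, that is, the directions spanned by the simplex. -/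
def sumZero (N : ℕ) : Submodule ℝ (EuclideanSpace ℝ (Fin (N + 1))) where
  carrier := {v | ∑ x, v x = 0}
  zero_mem' := by simp
  add_mem' {v w} hv hw := by simp_all [Finset.sum_add_distrib]
  smul_mem' c v hv := by simp_all [← Finset.mul_sum]

theorem sub_mem_sumZero (θ θ' : Simplex N) : θ.1 - θ'.1 ∈ sumZero N := by
  simp [sumZero, θ.2.1, θ'.2.1]

theorem exists_mul_norm_sub_sq_le_of_subset {ε κ : ℝ} (hε : ε ≠ 0) (hκ₀ : κ ≠ 0) (hκ₁ : κ < 1)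
    (S : ProperSubset N) :
    ∃ m > 0, ∀ θ θ' : Simplex N,
      m * ‖θ.1 - θ'.1‖ ^ 2 ≤ ∑ y, (h ε κ S y θ - h ε κ S y θ') ^ 2 := by
  let T : sumZero N →ₗ[ℝ] EuclideanSpace ℝ (Fin (N + 1)) :=
    (Matrix.of (g ε κ S)).toEuclideanLin.domRestrict (sumZero N)
  have hT_apply : ∀ v y, T v y = ∑ x, g ε κ S y x * v.1 x := fun _ _ => rfl
  have hT : LinearMap.ker T = ⊥ := by
    rw [LinearMap.ker_eq_bot']
    intro v hv
    have hzero := eq_zero_of_sum_g_mul_eq_zero hε hκ₀ hκ₁ S v.2 fun y => by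
      rw [← hT_apply, hv, PiLp.zero_apply]
    ext x
    exact congrFun hzero x
  obtain ⟨C, hC, hanti⟩ := T.exists_antilipschitzWith hT
  have hC_sq : (0 : ℝ) < C ^ 2 := pow_pos hC 2
  refine ⟨(C ^ 2 : ℝ)⁻¹, inv_pos.2 hC_sq, fun θ θ' => ?_⟩
  set v : sumZero N := ⟨θ.1 - θ'.1, sub_mem_sumZero θ θ'⟩
  have hTv : ‖T v‖ ^ 2 = ∑ y, (h ε κ S y θ - h ε κ S y θ') ^ 2 := by
    rw [EuclideanSpace.real_norm_sq_eq]
    simp_rw [h_sub_h, hT_apply, v]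
  rw [inv_mul_le_iff₀ hC_sq, ← hTv, ← mul_pow]
  have hnorm : ‖v‖ ≤ C * ‖T v‖ := ZeroHomClass.bound_of_antilipschitz T hanti v
  exact pow_le_pow_left₀ (norm_nonneg _) hnorm 2

instance : Nonempty (ProperSubset N) := ⟨⟨∅, Finset.univ_nonempty.ne_empty.symm⟩⟩

theorem exists_mul_norm_sub_sq_le {ε κ : ℝ} (hε : ε ≠ 0) (hκ₀ : κ ≠ 0) (hκ₁ : κ < 1) :
    ∃ m > 0, ∀ (S : ProperSubset N) (θ θ' : Simplex N),
      m * ‖θ.1 - θ'.1‖ ^ 2 ≤ ∑ y, (h ε κ S y θ - h ε κ S y θ') ^ 2 := by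
  choose m hm hle using exists_mul_norm_sub_sq_le_of_subset (N := N) hε hκ₀ hκ₁
  obtain ⟨S₀, hS₀⟩ := Finite.exists_min m
  exact ⟨m S₀, hm S₀, fun S θ θ' =>
    (mul_le_mul_of_nonneg_right (hS₀ S) (sq_nonneg _)).trans (hle S θ θ')⟩

/-! ### Likelihoods -/

theorem sqrt_mul_le {a b : ℝ} (ha : a ∈ Set.Icc 0 1) (hb : b ∈ Set.Icc 0 1) :
    √(a * b) ≤ (a + b) / 2 - (a - b) ^ 2 / 8 := by
  rw [Real.sqrt_mul ha.1]
  have hsq_a := Real.sq_sqrt ha.1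
  have hsq_b := Real.sq_sqrt hb.1
  have hsum : (√a + √b) ^ 2 ≤ 4 := by
    nlinarith [Real.sqrt_nonneg a, Real.sqrt_nonneg b, Real.sqrt_le_one.2 ha.2,
      Real.sqrt_le_one.2 hb.2]
  have hfactor : (a - b) ^ 2 = (√a - √b) ^ 2 * (√a + √b) ^ 2 := by
    rw [← mul_pow, ← hsq_a, ← hsq_b]
    simp only [Real.sqrt_sq (Real.sqrt_nonneg _)]
    ring
  nlinarith [mul_le_mul_of_nonneg_left hsum (sq_nonneg (√a - √b))]

theorem sum_sqrt_mul_le {ι : Type*} [Fintype ι] {p q : ι → ℝ} (hp : p ∈ stdSimplex ℝ ι)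
    (hq : q ∈ stdSimplex ℝ ι) :
    ∑ i, √(p i * q i) ≤ 1 - (∑ i, (p i - q i) ^ 2) / 8 := by
  calc ∑ i, √(p i * q i) ≤ ∑ i, ((p i + q i) / 2 - (p i - q i) ^ 2 / 8) :=
        Finset.sum_le_sum fun i _ =>
          sqrt_mul_le (mem_Icc_of_mem_stdSimplex hp i) (mem_Icc_of_mem_stdSimplex hq i)
    _ = _ := by
        rw [Finset.sum_sub_distrib, ← Finset.sum_div, ← Finset.sum_div, Finset.sum_add_distrib,
          hp.2, hq.2]
        ring

theorem toReal_responseLaw_apply (ε κ : ℝ) (θ : Simplex N) (S : ProperSubset N)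
    (y : Fin (N + 1)) : (responseLaw ε κ θ S y).toReal = h ε κ S y θ := by
  simp only [responseLaw, toReal_bind_apply, cat, PMF.ofFintype_apply,
    ENNReal.toReal_ofReal (θ.2.2 _), h, g, mul_comm]

theorem h_mem_stdSimplex (ε κ : ℝ) (S : ProperSubset N) (θ : Simplex N) :
    (fun y => h ε κ S y θ) ∈ stdSimplex ℝ (Fin (N + 1)) := by
  simpa only [toReal_responseLaw_apply] using toReal_mem_stdSimplex (responseLaw ε κ θ S)

theorem h_le_one (ε κ : ℝ) (S : ProperSubset N) (y : Fin (N + 1)) (θ : Simplex N) :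
    h ε κ S y θ ≤ 1 :=
  (mem_Icc_of_mem_stdSimplex (h_mem_stdSimplex ε κ S θ) y).2

/-- The least probability that the mechanism, with any proper subset and on any input, gives to
any response. It bounds the response probabilities below uniformly in the parameter. -/
noncomputable def minResponse (N : ℕ) (ε κ : ℝ) : ℝ :=
  ⨅ i : ProperSubset N × Fin (N + 1) × Fin (N + 1), g ε κ i.1 i.2.1 i.2.2

theorem minResponse_pos (N : ℕ) (ε κ : ℝ) : 0 < minResponse N ε κ := by
  obtain ⟨i, hi⟩ := exists_eq_ciInf_of_finite
    (f := fun i : ProperSubset N × Fin (N + 1) × Fin (N + 1) => g ε κ i.1 i.2.1 i.2.2)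
  rw [minResponse, ← hi]
  exact g_pos _ _ _ _ _

theorem minResponse_le_h (ε κ : ℝ) (S : ProperSubset N) (y : Fin (N + 1)) (θ : Simplex N) :
    minResponse N ε κ ≤ h ε κ S y θ := by
  calc minResponse N ε κ = ∑ x, minResponse N ε κ * θ.1 x := by
        rw [← Finset.mul_sum, θ.2.1, mul_one]
    _ ≤ h ε κ S y θ := Finset.sum_le_sum fun x _ => mul_le_mul_of_nonneg_right
        (ciInf_le (Set.finite_range _).bddBelow (S, y, x)) (θ.2.2 x)

theorem h_pos (ε κ : ℝ) (S : ProperSubset N) (y : Fin (N + 1)) (θ : Simplex N) :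
    0 < h ε κ S y θ :=
  (minResponse_pos N ε κ).trans_le (minResponse_le_h ε κ S y θ)

/-- The parameters each of whose entries is within `r` of that of `θ`. Neighbourhoods in the sup
norm are the convenient ones for nets and for the volume of shrunken simplices. -/
def coordBox (θ : Simplex N) (r : ℝ) : Set (Simplex N) :=
  {θ' | ∀ x, |θ'.1 x - θ.1 x| ≤ r}

theorem mem_coordBox_comm {θ θ' : Simplex N} {r : ℝ} :
    θ ∈ coordBox θ' r ↔ θ' ∈ coordBox θ r := by
  simp only [coordBox, Set.mem_ofPred_eq, abs_sub_comm]

theorem measurableSet_coordBox (θ : Simplex N) (r : ℝ) : MeasurableSet (coordBox θ r) := by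
  simp only [coordBox, Set.ofPred_forall]
  exact (isClosed_iInter fun x => isClosed_le (by fun_prop) (by fun_prop)).measurableSet

theorem h_sub_h_le (ε κ : ℝ) (S : ProperSubset N) (y : Fin (N + 1)) {θ θ' : Simplex N} {r : ℝ}
    (hr : θ ∈ coordBox θ' r) : h ε κ S y θ - h ε κ S y θ' ≤ (N + 1) * r := by
  rw [h_sub_h]
  calc ∑ x, g ε κ S y x * (θ.1 - θ'.1) x ≤ ∑ _x : Fin (N + 1), r := by
        refine Finset.sum_le_sum fun x _ => (le_abs_self _).trans ?_
        rw [abs_mul, abs_of_pos (g_pos ε κ S y x)]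
        exact (mul_le_of_le_one_left (abs_nonneg _) (g_le_one ε κ S y x)).trans (hr x)
    _ = (N + 1) * r := by simp

/-- The likelihood of the data at the parameter `θ`. -/
noncomputable def likelihood {n : ℕ} (ε κ : ℝ) (D : Data N n) (θ : Simplex N) : ℝ :=
  ∏ t, h ε κ (D t).1 (D t).2 θ

theorem likelihood_pos {n : ℕ} (ε κ : ℝ) (D : Data N n) (θ : Simplex N) :
    0 < likelihood ε κ D θ :=
  Finset.prod_pos fun _ _ => h_pos ε κ _ _ θ

theorem likelihood_le_one {n : ℕ} (ε κ : ℝ) (D : Data N n) (θ : Simplex N) :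
    likelihood ε κ D θ ≤ 1 :=
  Finset.prod_le_one (fun _ _ => (h_pos ε κ _ _ θ).le) fun _ _ => h_le_one ε κ _ _ θ

theorem continuous_likelihood {n : ℕ} (ε κ : ℝ) (D : Data N n) :
    Continuous (likelihood ε κ D) := by
  unfold likelihood h
  fun_prop

/-- A bound for the likelihood ratio of `n` observations between parameters in a common box of
radius `1 / n`: each of the `n` factors is at most `exp ((N + 1) / (n * minResponse N ε κ))`. -/
noncomputable def likelihoodConst (N : ℕ) (ε κ : ℝ) : ℝ :=
  Real.exp ((N + 1) / minResponse N ε κ)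

theorem likelihoodConst_pos (N : ℕ) (ε κ : ℝ) : 0 < likelihoodConst N ε κ :=
  Real.exp_pos _

theorem h_le_exp_mul (ε κ : ℝ) (S : ProperSubset N) (y : Fin (N + 1)) {θ θ' : Simplex N} {r : ℝ}
    (hr₀ : 0 ≤ r) (hr : θ ∈ coordBox θ' r) :
    h ε κ S y θ ≤ Real.exp ((N + 1) / minResponse N ε κ * r) * h ε κ S y θ' := by
  have hb := minResponse_pos N ε κ
  have hb_le := minResponse_le_h ε κ S y θ'
  calc h ε κ S y θ ≤ (N + 1) * r + h ε κ S y θ' := by linarith [h_sub_h_le ε κ S y hr]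
    _ = (N + 1) / minResponse N ε κ * r * minResponse N ε κ + h ε κ S y θ' := by field_simp
    _ ≤ (N + 1) / minResponse N ε κ * r * h ε κ S y θ' + h ε κ S y θ' := by gcongr
    _ = ((N + 1) / minResponse N ε κ * r + 1) * h ε κ S y θ' := by ring
    _ ≤ _ := mul_le_mul_of_nonneg_right (Real.add_one_le_exp _) (h_pos ε κ S y θ').le

theorem likelihood_le_mul {n : ℕ} (ε κ : ℝ) (D : Data N n) {θ θ' : Simplex N}
    (hθ : θ ∈ coordBox θ' (1 / n)) :
    likelihood ε κ D θ ≤ likelihoodConst N ε κ * likelihood ε κ D θ' := by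
  have hb := minResponse_pos N ε κ
  calc likelihood ε κ D θ
      ≤ ∏ t, Real.exp ((N + 1) / minResponse N ε κ * (1 / n)) * h ε κ (D t).1 (D t).2 θ' :=
        Finset.prod_le_prod (fun t _ => (h_pos ε κ _ _ θ).le) fun t _ =>
          h_le_exp_mul ε κ _ _ (by positivity) hθ
    _ = Real.exp (n * ((N + 1) / minResponse N ε κ * (1 / n))) * likelihood ε κ D θ' := by
        rw [Finset.prod_mul_distrib, Finset.prod_const, Finset.card_univ, Fintype.card_fin,
          ← Real.exp_nat_mul, likelihood]
    _ ≤ likelihoodConst N ε κ * likelihood ε κ D θ' := by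
        refine mul_le_mul_of_nonneg_right (Real.exp_le_exp.2 ?_) (likelihood_pos ε κ D θ').le
        rw [mul_left_comm]
        exact mul_le_of_le_one_right (by positivity) (by simpa using mul_inv_le_one)

/-- The square root of the likelihood ratio of `θ` against `θ₀`, whose mean under `θ₀` is a
Hellinger affinity. -/
noncomputable def rootLikelihoodRatio {n : ℕ} (ε κ : ℝ) (D : Data N n) (θ₀ θ : Simplex N) : ℝ :=
  √(likelihood ε κ D θ / likelihood ε κ D θ₀)

theorem rootLikelihoodRatio_nonneg {n : ℕ} (ε κ : ℝ) (D : Data N n) (θ₀ θ : Simplex N) :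
    0 ≤ rootLikelihoodRatio ε κ D θ₀ θ :=
  Real.sqrt_nonneg _

theorem rootLikelihoodRatio_eq_prod {n : ℕ} (ε κ : ℝ) (D : Data N n) (θ₀ θ : Simplex N) :
    rootLikelihoodRatio ε κ D θ₀ θ =
      ∏ t, √(h ε κ (D t).1 (D t).2 θ / h ε κ (D t).1 (D t).2 θ₀) := by
  rw [rootLikelihoodRatio, likelihood, likelihood, ← Finset.prod_div_distrib,
    Real.sqrt_prod _ fun t _ => (div_pos (h_pos ε κ _ _ θ) (h_pos ε κ _ _ θ₀)).le]

theorem lintegral_sqrt_h_div_h_le (ε κ : ℝ) (S : ProperSubset N) (θ₀ θ : Simplex N) :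
    ∫⁻ y, ENNReal.ofReal √(h ε κ S y θ / h ε κ S y θ₀) ∂(responseLaw ε κ θ₀ S).toMeasure ≤
      ENNReal.ofReal (1 - (∑ y, (h ε κ S y θ - h ε κ S y θ₀) ^ 2) / 8) := by
  have hterm : ∀ y, ENNReal.ofReal √(h ε κ S y θ / h ε κ S y θ₀) *
      (responseLaw ε κ θ₀ S).toMeasure {y} = ENNReal.ofReal √(h ε κ S y θ * h ε κ S y θ₀) := by
    intro y
    have hpos := h_pos ε κ S y θ₀
    rw [PMF.toMeasure_apply_singleton _ _ (measurableSet_singleton y),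
      ← ENNReal.ofReal_toReal (PMF.apply_ne_top (responseLaw ε κ θ₀ S) y),
      toReal_responseLaw_apply, ← ENNReal.ofReal_mul (Real.sqrt_nonneg _)]
    congr 1
    rw [Real.sqrt_div' _ hpos.le, Real.sqrt_mul' _ hpos.le, div_mul_eq_mul_div, mul_div_assoc,
      Real.div_sqrt]
  rw [lintegral_fintype, Finset.sum_congr rfl fun y _ => hterm y,
    ← ENNReal.ofReal_sum_of_nonneg fun y _ => Real.sqrt_nonneg _]
  exact ENNReal.ofReal_le_ofReal
    (sum_sqrt_mul_le (h_mem_stdSimplex ε κ S θ) (h_mem_stdSimplex ε κ S θ₀))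

/-! ### Likelihood ratios along trajectories -/

section Trajectories

variable {X : ℕ → Type*} [∀ n, MeasurableSpace (X n)] (μ₀ : Measure (X 0))
  (κ : (n : ℕ) → Kernel ((i : Finset.Iic n) → X i) (X (n + 1))) [∀ n, IsMarkovKernel (κ n)]

theorem map_eval_zero_trajMeasure :
    (Kernel.trajMeasure μ₀ κ).map (fun ω => ω 0) = μ₀ := by
  let e := MeasurableEquiv.piUnique fun i : Finset.Iic 0 => X i
  have hrestrict : (Kernel.trajMeasure μ₀ κ).map (Preorder.frestrictLe 0) = μ₀.map e.symm := by
    rw [Kernel.trajMeasure, Measure.map_comp _ _ (by fun_prop), Kernel.traj_map_frestrictLe,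
      Kernel.partialTraj_self, Measure.id_comp]
  have hcomp := Measure.map_map (μ := Kernel.trajMeasure μ₀ κ) e.measurable
    (Preorder.measurable_frestrictLe 0)
  rw [hrestrict] at hcomp
  exact hcomp.symm.trans (MeasurableEquiv.map_map_symm e)

variable [IsProbabilityMeasure μ₀]

theorem lintegral_mul_trajMeasure_le {n : ℕ} {G : ((i : Finset.Iic n) → X i) → ENNReal}
    (hG : Measurable G) {f : X (n + 1) → ENNReal} (hf : Measurable f) {ρ : ENNReal}
    (hρ : ∀ r, ∫⁻ x, f x ∂(κ n r) ≤ ρ) :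
    ∫⁻ ω, G (Preorder.frestrictLe n ω) * f (ω (n + 1)) ∂(Kernel.trajMeasure μ₀ κ) ≤
      (∫⁻ ω, G (Preorder.frestrictLe n ω) ∂(Kernel.trajMeasure μ₀ κ)) * ρ := by
  have hmeas : Measurable fun p : ((i : Finset.Iic n) → X i) × X (n + 1) => G p.1 * f p.2 := by
    fun_prop
  calc ∫⁻ ω, G (Preorder.frestrictLe n ω) * f (ω (n + 1)) ∂(Kernel.trajMeasure μ₀ κ)
      = ∫⁻ p, G p.1 * f p.2 ∂((Kernel.trajMeasure μ₀ κ).map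
          fun ω => (Preorder.frestrictLe n ω, ω (n + 1))) := by
        rw [lintegral_map hmeas (by fun_prop)]
    _ = ∫⁻ r, G r * ∫⁻ x, f x ∂(κ n r)
          ∂((Kernel.trajMeasure μ₀ κ).map (Preorder.frestrictLe n)) := by
        rw [← Kernel.map_frestrictLe_trajMeasure_compProd_eq_map_trajMeasure,
          Measure.lintegral_compProd hmeas]
        simp_rw [lintegral_const_mul _ hf]
    _ ≤ ∫⁻ r, G r * ρ ∂((Kernel.trajMeasure μ₀ κ).map (Preorder.frestrictLe n)) := by
        gcongr with r
        exact hρ r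
    _ = (∫⁻ ω, G (Preorder.frestrictLe n ω) ∂(Kernel.trajMeasure μ₀ κ)) * ρ := by
        rw [lintegral_mul_const _ hG, lintegral_map hG (by fun_prop)]

theorem lintegral_prod_trajMeasure_le {f : (n : ℕ) → X n → ENNReal}
    (hf : ∀ n, Measurable (f n)) {ρ : ℕ → ENNReal} (hρ₀ : ∫⁻ x, f 0 x ∂μ₀ ≤ ρ 0)
    (hρ : ∀ n r, ∫⁻ x, f (n + 1) x ∂(κ n r) ≤ ρ (n + 1)) (n : ℕ) :
    ∫⁻ ω, ∏ i ∈ Finset.range n, f i (ω i) ∂(Kernel.trajMeasure μ₀ κ) ≤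
      ∏ i ∈ Finset.range n, ρ i := by
  rcases n with _ | n
  · simp
  induction n with
  | zero =>
    simp only [zero_add, Finset.prod_range_one]
    rwa [← lintegral_map (hf 0) (by fun_prop), map_eval_zero_trajMeasure]
  | succ n ih =>
    have hprod : ∀ ω : (n : ℕ) → X n, ∏ i ∈ Finset.range (n + 1), f i (ω i) =
        ∏ i : Finset.Iic n, f i (Preorder.frestrictLe n ω i) := by
      intro ω
      rw [Nat.range_succ_eq_Iic, ← Finset.prod_coe_sort]
      rfl
    simp_rw [hprod] at ih
    simp_rw [Finset.prod_range_succ _ (n + 1), hprod]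
    have hmeas : Measurable fun r : (i : Finset.Iic n) → X i => ∏ i : Finset.Iic n, f i (r i) := by
      fun_prop
    calc _ ≤ _ := lintegral_mul_trajMeasure_le μ₀ κ hmeas (hf (n + 1)) (hρ n)
      _ ≤ _ := by gcongr

end Trajectories

instance (ε κ : ℝ) (θ : Simplex N) : IsMarkovKernel (Kernel.ofFunOfCountable
    fun S : ProperSubset N => (responseLaw ε κ θ S).toMeasure) :=
  ⟨fun S => PMF.toMeasure.isProbabilityMeasure (responseLaw ε κ θ S)⟩

theorem lintegral_observe (ε κ : ℝ) (θstar : Simplex N) {sel : Simplex N → ProperSubset N}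
    (hsel : Measurable sel) (f : ProperSubset N × Fin (N + 1) → ENNReal) (θ : Simplex N) :
    ∫⁻ r, f r.2 ∂(observe ε κ θstar sel hsel θ) =
      ∫⁻ y, f (sel θ, y) ∂(responseLaw ε κ θstar (sel θ)).toMeasure := by
  have hf : Measurable f := measurable_of_countable f
  unfold observe
  rw [Kernel.lintegral_prod _ _ _ (by fun_prop : Measurable fun r : Record N => f r.2),
    Kernel.lintegral_deterministic' _ (by fun_prop), Kernel.lintegral_compProd _ _ _ hf,
    Kernel.lintegral_deterministic' _ (measurable_of_countable _)]
  rfl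

theorem lintegral_prod_law_le (ε κ : ℝ) (θstar θinit : Simplex N)
    {sel : Simplex N → ProperSubset N} (hsel : Measurable sel)
    (Q : (n : ℕ) → Kernel (Data N n × Simplex N) (Simplex N)) [∀ n, IsMarkovKernel (Q n)]
    {f : ProperSubset N × Fin (N + 1) → ENNReal} {ρ : ENNReal}
    (hρ : ∀ S, ∫⁻ y, f (S, y) ∂(responseLaw ε κ θstar S).toMeasure ≤ ρ) (n : ℕ) :
    ∫⁻ ω, ∏ i, f (data n ω i) ∂(law ε κ θstar θinit sel hsel Q) ≤ ρ ^ n := by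
  have hf : Measurable fun r : Record N => f r.2 :=
    (measurable_of_countable f).comp measurable_snd
  have hobs : ∀ θ, ∫⁻ r, f r.2 ∂(observe ε κ θstar sel hsel θ) ≤ ρ := fun θ =>
    (lintegral_observe ε κ θstar hsel f θ).trans_le (hρ _)
  have hstep : ∀ n r, ∫⁻ x, f x.2 ∂(step ε κ θstar sel hsel Q n r) ≤ ρ := by
    intro n r
    rw [step, Kernel.lintegral_comp _ _ _ hf]
    calc _ ≤ ∫⁻ _, ρ ∂((Q (n + 1)).comap (history n) (measurable_history n) r) :=
          lintegral_mono hobs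
      _ = ρ := by simp
  have hprod : ∀ ω : ℕ → Record N,
      ∏ i, f (data n ω i) = ∏ i ∈ Finset.range n, f (ω i).2 := fun ω =>
    Fin.prod_univ_eq_prod_range (fun i => f (ω i).2) n
  simp_rw [hprod]
  simpa only [law, Finset.prod_const, Finset.card_range] using
    lintegral_prod_trajMeasure_le (X := fun _ => Record N) _ _ (f := fun _ r => f r.2)
      (fun _ => hf) (ρ := fun _ => ρ) (hobs θinit) hstep n

theorem exists_lintegral_rootLikelihoodRatio_le {ε κ : ℝ} (hε : ε ≠ 0) (hκ₀ : κ ≠ 0)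
    (hκ₁ : κ < 1) :
    ∃ δ > 0, ∀ (θstar θinit : Simplex N) (sel : Simplex N → ProperSubset N) (hsel : Measurable sel)
      (Q : (n : ℕ) → Kernel (Data N n × Simplex N) (Simplex N)) [∀ n, IsMarkovKernel (Q n)]
      (θ : Simplex N) (n : ℕ),
      ∫⁻ ω, ENNReal.ofReal (rootLikelihoodRatio ε κ (data n ω) θstar θ)
        ∂(law ε κ θstar θinit sel hsel Q) ≤
      ENNReal.ofReal (Real.exp (-(n * (δ * ‖θ.1 - θstar.1‖ ^ 2)))) := by
  obtain ⟨m, hm, hle⟩ := exists_mul_norm_sub_sq_le (N := N) hε hκ₀ hκ₁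
  refine ⟨m / 8, by positivity, fun θstar θinit sel hsel Q _ θ n => ?_⟩
  have hρ : ∀ S, ∫⁻ y, ENNReal.ofReal √(h ε κ S y θ / h ε κ S y θstar)
      ∂(responseLaw ε κ θstar S).toMeasure ≤
        ENNReal.ofReal (Real.exp (-(m / 8 * ‖θ.1 - θstar.1‖ ^ 2))) := by
    intro S
    refine (lintegral_sqrt_h_div_h_le ε κ S θstar θ).trans (ENNReal.ofReal_le_ofReal ?_)
    have hexp := Real.add_one_le_exp (-(m / 8 * ‖θ.1 - θstar.1‖ ^ 2))
    linarith [hle S θ θstar]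
  simp_rw [rootLikelihoodRatio_eq_prod,
    ENNReal.ofReal_prod_of_nonneg fun _ _ => Real.sqrt_nonneg _]
  refine (lintegral_prod_law_le ε κ θstar θinit hsel Q
    (f := fun p => ENNReal.ofReal √(h ε κ p.1 p.2 θ / h ε κ p.1 p.2 θstar)) hρ n).trans_eq ?_
  rw [← ENNReal.ofReal_pow (Real.exp_pos _).le, ← Real.exp_nat_mul, mul_neg]

/-! ### The reference measure -/

theorem apply_mem_Icc (θ : Simplex N) (x : Fin (N + 1)) : θ.1 x ∈ Set.Icc (0 : ℝ) 1 :=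
  mem_Icc_of_mem_stdSimplex ⟨θ.2.2, θ.2.1⟩ x

theorem continuous_freeCoords : Continuous (freeCoords (N := N)) := by
  unfold freeCoords
  fun_prop

theorem freeCoords_injective : Function.Injective (freeCoords (N := N)) := by
  intro θ θ' hθ
  have hcast : ∀ i : Fin N, θ.1 i.castSucc = θ'.1 i.castSucc := congrFun hθ
  have hsum : ∑ x, θ.1 x = ∑ x, θ'.1 x := θ.2.1.trans θ'.2.1.symm
  simp only [Fin.sum_univ_castSucc, hcast, add_right_inj] at hsum
  ext x
  induction x using Fin.lastCases with
  | last => exact hsum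
  | cast i => exact hcast i

theorem measurableEmbedding_freeCoords : MeasurableEmbedding (freeCoords (N := N)) := by
  have hsum : IsClosed {θ : EuclideanSpace ℝ (Fin (N + 1)) | ∑ k, θ k = 1} :=
    isClosed_eq (by fun_prop) (by fun_prop)
  have hnonneg : IsClosed {θ : EuclideanSpace ℝ (Fin (N + 1)) | ∀ k, 0 ≤ θ k} := by
    rw [Set.ofPred_forall]
    exact isClosed_iInter fun k => isClosed_le (by fun_prop) (by fun_prop)
  have : PolishSpace (Simplex N) := (hsum.inter hnonneg).polishSpace
  exact continuous_freeCoords.measurableEmbedding freeCoords_injective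

theorem lebesgueSimplex_apply (A : Set (Simplex N)) :
    lebesgueSimplex N A = volume (freeCoords '' A) :=
  measurableEmbedding_freeCoords.comap_apply _ _

instance : IsFiniteMeasure (lebesgueSimplex N) := by
  refine ⟨?_⟩
  rw [lebesgueSimplex_apply]
  refine lt_of_le_of_lt (measure_mono (t := Set.Icc 0 1) ?_) isCompact_Icc.measure_lt_top
  rintro _ ⟨θ, -, rfl⟩
  exact ⟨fun i => (apply_mem_Icc θ _).1, fun i => (apply_mem_Icc θ _).2⟩

theorem exists_mem_coordBox_freeCoords_eq_homothety (θ φ : Simplex N) {r : ℝ} (hr₀ : 0 ≤ r)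
    (hr₁ : r ≤ 1) :
    ∃ θ' ∈ coordBox θ r,
      freeCoords θ' = AffineMap.homothety (freeCoords θ) r (freeCoords φ) := by
  have happly : ∀ x, ((1 - r) • θ.1 + r • φ.1) x = r * (φ.1 x - θ.1 x) + θ.1 x := by
    intro x
    simp only [PiLp.add_apply, PiLp.smul_apply, smul_eq_mul]
    ring
  refine ⟨⟨(1 - r) • θ.1 + r • φ.1, ?_, fun x => ?_⟩, fun x => ?_, ?_⟩
  · simp [Finset.sum_add_distrib, ← Finset.mul_sum, θ.2.1, φ.2.1]
  · exact add_nonneg (mul_nonneg (sub_nonneg.2 hr₁) (θ.2.2 x)) (mul_nonneg hr₀ (φ.2.2 x))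
  · rw [happly, add_sub_cancel_right, abs_mul, abs_of_nonneg hr₀]
    refine mul_le_of_le_one_right hr₀ ((abs_sub_le_of_le_of_le (φ.2.2 x) (apply_mem_Icc φ x).2
      (θ.2.2 x) (apply_mem_Icc θ x).2).trans_eq (sub_zero 1))
  · ext i
    exact happly i.castSucc

theorem pow_mul_measureReal_univ_le (θ : Simplex N) {r : ℝ} (hr₀ : 0 ≤ r) (hr₁ : r ≤ 1) :
    r ^ N * (lebesgueSimplex N).real Set.univ ≤ (lebesgueSimplex N).real (coordBox θ r) := by
  have hsub : AffineMap.homothety (freeCoords θ) r '' (freeCoords '' Set.univ) ⊆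
      freeCoords '' coordBox θ r := by
    rintro _ ⟨_, ⟨φ, -, rfl⟩, rfl⟩
    exact exists_mem_coordBox_freeCoords_eq_homothety θ φ hr₀ hr₁
  have hle := measure_mono (μ := volume) hsub
  rw [Measure.addHaar_image_homothety, ← lebesgueSimplex_apply, ← lebesgueSimplex_apply,
    Module.finrank_fin_fun, abs_of_nonneg (pow_nonneg hr₀ N)] at hle
  simpa [Measure.real, ENNReal.toReal_ofReal (pow_nonneg hr₀ N)] using
    ENNReal.toReal_mono (measure_ne_top _ _) hle

theorem measureReal_univ_le_pow_mul (θ : Simplex N) {n : ℕ} (hn : 0 < n) :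
    (lebesgueSimplex N).real Set.univ ≤ n ^ N * (lebesgueSimplex N).real (coordBox θ (1 / n)) := by
  have hn' : (1 : ℝ) ≤ n := by exact_mod_cast hn
  rw [← div_le_iff₀' (by positivity), div_eq_inv_mul, ← inv_pow, ← one_div]
  exact pow_mul_measureReal_univ_le θ (by positivity) (div_le_one_of_le₀ hn' (by positivity))

/-! ### Nets and averages -/

theorem exists_net {α ι : Type*} [Fintype ι] {u : α → ι → ℝ}
    (hu : ∀ a i, u a i ∈ Set.Icc (0 : ℝ) 1) (A : Set α) {n : ℕ} (hn : 0 < n) :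
    ∃ T : Finset α, ↑T ⊆ A ∧ T.card ≤ (n + 1) ^ Fintype.card ι ∧
      ∀ a ∈ A, ∃ b ∈ T, ∀ i, |u a i - u b i| ≤ 1 / n := by
  classical
  have hn' : (0 : ℝ) < n := by exact_mod_cast hn
  let cell : α → ι → Fin (n + 1) := fun a i =>
    ⟨⌊n * u a i⌋₊, Nat.lt_succ_of_le (Nat.floor_le_of_le
      (mul_le_of_le_one_right hn'.le (hu a i).2))⟩
  obtain ⟨s, hsA, hs⟩ := Set.exists_subset_bijOn A cell
  have hfin : s.Finite := Set.Finite.of_finite_image (Set.toFinite _) hs.injOn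
  refine ⟨hfin.toFinset, by simpa using hsA, ?_, fun a ha => ?_⟩
  · calc hfin.toFinset.card ≤ (Finset.univ : Finset (ι → Fin (n + 1))).card :=
          Finset.card_le_card_of_injOn cell (fun _ _ => Finset.mem_coe.2 (Finset.mem_univ _))
            (by simpa using hs.injOn)
      _ = _ := by simp
  · obtain ⟨b, hb, hcell⟩ := hs.surjOn ⟨a, ha, rfl⟩
    refine ⟨b, hfin.mem_toFinset.2 hb, fun i => ?_⟩
    have hfloor : ⌊n * u b i⌋₊ = ⌊n * u a i⌋₊ := congrArg Fin.val (congrFun hcell i)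
    have hdist : |n * u a i - n * u b i| < 1 := by
      refine Int.abs_sub_lt_one_of_floor_eq_floor ?_
      rw [← Int.natCast_floor_eq_floor (mul_nonneg hn'.le (hu a i).1),
        ← Int.natCast_floor_eq_floor (mul_nonneg hn'.le (hu b i).1), hfloor]
    rw [← mul_sub, abs_mul, Nat.abs_cast] at hdist
    rw [le_div_iff₀' hn']
    exact hdist.le

theorem setIntegral_mul_measureReal_le {α : Type*} [MeasurableSpace α] {ν : Measure α}
    [IsFiniteMeasure ν] {f : α → ℝ} (hf : Integrable f ν) {s t : Set α} (hs : MeasurableSet s)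
    (ht : MeasurableSet t) {C : ℝ} (hle : ∀ x ∈ s, ∀ y ∈ t, f x ≤ C * f y) :
    (∫ x in s, f x ∂ν) * ν.real t ≤ C * ν.real s * ∫ y in t, f y ∂ν := by
  have hinner : ∀ y ∈ t, ∫ x in s, f x ∂ν ≤ C * ν.real s * f y := by
    intro y hy
    calc ∫ x in s, f x ∂ν ≤ ∫ _ in s, C * f y ∂ν :=
          setIntegral_mono_on hf.integrableOn (integrable_const _) hs fun x hx => hle x hx y hy
      _ = C * ν.real s * f y := by
          rw [setIntegral_const, smul_eq_mul]
          ring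
  calc (∫ x in s, f x ∂ν) * ν.real t = ∫ _ in t, ∫ x in s, f x ∂ν ∂ν := by
        rw [setIntegral_const, smul_eq_mul, mul_comm]
    _ ≤ ∫ y in t, C * ν.real s * f y ∂ν :=
        setIntegral_mono_on (integrable_const _) (hf.integrableOn.const_mul _) ht hinner
    _ = C * ν.real s * ∫ y in t, f y ∂ν := integral_const_mul _ _

theorem norm_le_sqrt_card_mul {ι : Type*} [Fintype ι] {v : EuclideanSpace ℝ ι} {r : ℝ}
    (hr : 0 ≤ r) (hv : ∀ i, |v i| ≤ r) : ‖v‖ ≤ √(Fintype.card ι) * r := by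
  have hsum : ∑ i, ‖v i‖ ^ 2 ≤ Fintype.card ι * r ^ 2 := by
    simpa using Finset.sum_le_card_nsmul Finset.univ (fun i => ‖v i‖ ^ 2) (r ^ 2)
      fun i _ => pow_le_pow_left₀ (norm_nonneg _) (hv i) 2
  calc ‖v‖ = √(∑ i, ‖v i‖ ^ 2) := EuclideanSpace.norm_eq v
    _ ≤ √(Fintype.card ι * r ^ 2) := Real.sqrt_le_sqrt hsum
    _ = √(Fintype.card ι) * r := by rw [Real.sqrt_mul (Nat.cast_nonneg _), Real.sqrt_sq hr]

/-! ### The posterior -/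

variable {ε κ : ℝ} {η : Simplex N → ℝ} {θstar : Simplex N} {n : ℕ}

theorem PriorRatioBounded.eventually_le_mul (hη : PriorRatioBounded η θstar) :
    ∃ B > 0, ∀ᶠ n : ℕ in atTop, ∀ θ, ∀ θ' ∈ coordBox θstar (1 / n), η θ ≤ B * η θ' := by
  obtain ⟨d, hd, B, hB, hratio⟩ := hη
  have hmesh : Tendsto (fun n : ℕ => √(Fintype.card (Fin (N + 1))) * (1 / (n : ℝ))) atTop
      (nhds 0) := by
    simpa only [mul_zero] using (tendsto_one_div_atTop_nhds_zero_nat (𝕜 := ℝ)).const_mul _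
  refine ⟨B, hB, (hmesh.eventually_lt_const hd).mono fun n hn θ θ' hθ' => ?_⟩
  obtain ⟨hpos, hlt⟩ := hratio θ θ' ((norm_le_sqrt_card_mul (v := θ'.1 - θstar.1)
    (by positivity) hθ').trans_lt hn)
  exact ((div_lt_iff₀ hpos).1 hlt).le

theorem IsPriorDensity.measureReal_univ_pos (hη : IsPriorDensity η) :
    0 < (lebesgueSimplex N).real Set.univ := by
  have hne : lebesgueSimplex N ≠ 0 := fun hzero => by
    simpa [hzero] using hη.integral_eq_one
  exact ENNReal.toReal_pos (Measure.measure_univ_ne_zero.2 hne) (measure_ne_top _ _)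

theorem IsPriorDensity.integrable_mul_likelihood (hη : IsPriorDensity η) (D : Data N n) :
    Integrable (fun θ => η θ * likelihood ε κ D θ) (lebesgueSimplex N) := by
  refine (integrable_of_integral_eq_one hη.integral_eq_one).mul_bdd (c := 1)
    (continuous_likelihood ε κ D).aestronglyMeasurable (ae_of_all _ fun θ => ?_)
  rw [Real.norm_of_nonneg (likelihood_pos ε κ D θ).le]
  exact likelihood_le_one ε κ D θ

theorem IsPriorDensity.mul_likelihood_nonneg (hη : IsPriorDensity η) (D : Data N n)
    (θ : Simplex N) : 0 ≤ η θ * likelihood ε κ D θ :=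
  mul_nonneg (hη.nonneg θ) (likelihood_pos ε κ D θ).le

theorem IsPriorDensity.integral_mul_likelihood_pos (hη : IsPriorDensity η) (D : Data N n) :
    0 < ∫ θ, η θ * likelihood ε κ D θ ∂(lebesgueSimplex N) := by
  have hsupport : Function.support (fun θ => η θ * likelihood ε κ D θ) = Function.support η := by
    ext θ
    simp [(likelihood_pos ε κ D θ).ne']
  rw [integral_pos_iff_support_of_nonneg (hη.mul_likelihood_nonneg D)
    (hη.integrable_mul_likelihood D), hsupport, ← integral_pos_iff_support_of_nonneg hη.nonneg
    (integrable_of_integral_eq_one hη.integral_eq_one), hη.integral_eq_one]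
  exact one_pos

theorem posterior_eq (D : Data N n) (A : Set (Simplex N)) :
    posterior ε κ η D A = (∫ θ in A, η θ * likelihood ε κ D θ ∂(lebesgueSimplex N)) /
      ∫ θ, η θ * likelihood ε κ D θ ∂(lebesgueSimplex N) :=
  rfl

theorem IsPriorDensity.posterior_nonneg (hη : IsPriorDensity η) (D : Data N n)
    (A : Set (Simplex N)) : 0 ≤ posterior ε κ η D A :=
  div_nonneg (integral_nonneg (hη.mul_likelihood_nonneg D))
    (integral_nonneg (hη.mul_likelihood_nonneg D))

theorem IsPriorDensity.abs_posterior_sub_one (hη : IsPriorDensity η) (D : Data N n)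
    {A : Set (Simplex N)} (hA : MeasurableSet A) :
    |posterior ε κ η D A - 1| = posterior ε κ η D Aᶜ := by
  have hadd : posterior ε κ η D A + posterior ε κ η D Aᶜ = 1 := by
    rw [posterior_eq, posterior_eq, ← add_div,
      integral_add_compl hA (hη.integrable_mul_likelihood D),
      div_self (hη.integral_mul_likelihood_pos D).ne']
  rw [← hadd, sub_add_cancel_left, abs_neg, abs_of_nonneg (hη.posterior_nonneg D Aᶜ)]

/-- The evidence is bounded below by the contribution of a box of radius `1 / n` around `θstar`,
on which neither the prior nor the likelihood is much smaller than anywhere in `A`. -/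
theorem IsPriorDensity.posterior_le (hη : IsPriorDensity η) (hn : 0 < n) {B : ℝ} (hB : 0 ≤ B)
    (hratio : ∀ θ, ∀ θ' ∈ coordBox θstar (1 / n), η θ ≤ B * η θ') (D : Data N n)
    {A : Set (Simplex N)} (hA : MeasurableSet A) {M : ℝ} (hM : 0 ≤ M)
    (hAM : ∀ θ ∈ A, likelihood ε κ D θ ≤ M * likelihood ε κ D θstar) :
    posterior ε κ η D A ≤ B * likelihoodConst N ε κ * M * n ^ N := by
  have hL := likelihoodConst_pos N ε κ
  set ν := lebesgueSimplex N
  set f : Simplex N → ℝ := fun θ => η θ * likelihood ε κ D θ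
  set C := B * likelihoodConst N ε κ * M
  have : 0 ≤ C := by positivity
  have hV := hη.measureReal_univ_pos
  have hf := hη.integrable_mul_likelihood (ε := ε) (κ := κ) D
  have hle : ∀ θ ∈ A, ∀ θ' ∈ coordBox θstar (1 / n), f θ ≤ C * f θ' := by
    intro θ hθ θ' hθ'
    calc f θ ≤ (B * η θ') * (M * (likelihoodConst N ε κ * likelihood ε κ D θ')) := by
          refine mul_le_mul (hratio θ θ' hθ') ((hAM θ hθ).trans ?_) (likelihood_pos ε κ D θ).le
            (mul_nonneg hB (hη.nonneg θ'))
          exact mul_le_mul_of_nonneg_left (likelihood_le_mul ε κ D (mem_coordBox_comm.1 hθ')) hM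
      _ = C * f θ' := by ring
  have hint : (∫ θ in A, f θ ∂ν) * ν.real Set.univ ≤
      C * n ^ N * (∫ θ, f θ ∂ν) * ν.real Set.univ := by
    calc (∫ θ in A, f θ ∂ν) * ν.real Set.univ
        ≤ (∫ θ in A, f θ ∂ν) * (n ^ N * ν.real (coordBox θstar (1 / n))) :=
          mul_le_mul_of_nonneg_left (measureReal_univ_le_pow_mul θstar hn)
            (integral_nonneg (hη.mul_likelihood_nonneg D))
      _ = n ^ N * ((∫ θ in A, f θ ∂ν) * ν.real (coordBox θstar (1 / n))) := by ring
      _ ≤ n ^ N * (C * ν.real A * ∫ θ in coordBox θstar (1 / n), f θ ∂ν) := by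
          exact mul_le_mul_of_nonneg_left
            (setIntegral_mul_measureReal_le hf hA (measurableSet_coordBox _ _) hle) (by positivity)
      _ ≤ n ^ N * (C * ν.real Set.univ * ∫ θ, f θ ∂ν) := by
          have hbox_le := setIntegral_le_integral (s := coordBox θstar (1 / n)) hf
            (ae_of_all _ (hη.mul_likelihood_nonneg D))
          have hbox_nonneg : 0 ≤ ∫ θ in coordBox θstar (1 / n), f θ ∂ν :=
            integral_nonneg (hη.mul_likelihood_nonneg D)
          have hA_le : ν.real A ≤ ν.real Set.univ := measureReal_mono (Set.subset_univ A)
          gcongr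
      _ = C * n ^ N * (∫ θ, f θ ∂ν) * ν.real Set.univ := by ring
  rw [posterior_eq, div_le_iff₀ (hη.integral_mul_likelihood_pos D)]
  exact le_of_mul_le_mul_right hint hV

/-! ### Posterior contraction -/

theorem likelihood_eq_sq_rootLikelihoodRatio_mul (D : Data N n) (θ₀ θ : Simplex N) :
    likelihood ε κ D θ = rootLikelihoodRatio ε κ D θ₀ θ ^ 2 * likelihood ε κ D θ₀ := by
  have hpos := likelihood_pos ε κ D
  rw [rootLikelihoodRatio, Real.sq_sqrt (div_pos (hpos θ) (hpos θ₀)).le,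
    div_mul_cancel₀ _ (hpos θ₀).ne']

theorem IsPriorDensity.exists_sqrt_posterior_le (hη : IsPriorDensity η) (hn : 0 < n) {B : ℝ}
    (hB : 0 ≤ B) (hratio : ∀ θ, ∀ θ' ∈ coordBox θstar (1 / n), η θ ≤ B * η θ')
    {A : Set (Simplex N)} (hA : MeasurableSet A) :
    ∃ T : Finset (Simplex N), ↑T ⊆ A ∧ T.card ≤ (n + 1) ^ (N + 1) ∧ ∀ D : Data N n,
      √(posterior ε κ η D A) ≤
        √B * likelihoodConst N ε κ * n ^ N * ∑ θ ∈ T, rootLikelihoodRatio ε κ D θstar θ := by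
  obtain ⟨T, hTA, hcard, hT⟩ := exists_net (apply_mem_Icc (N := N)) A hn
  rw [Fintype.card_fin] at hcard
  refine ⟨T, hTA, hcard, fun D => ?_⟩
  have hL := likelihoodConst_pos N ε κ
  set L := likelihoodConst N ε κ
  set Z := ∑ θ ∈ T, rootLikelihoodRatio ε κ D θstar θ
  have hZ : 0 ≤ Z := Finset.sum_nonneg fun θ _ => rootLikelihoodRatio_nonneg ε κ D θstar θ
  have hAM : ∀ θ ∈ A, likelihood ε κ D θ ≤ L * Z ^ 2 * likelihood ε κ D θstar := by
    intro θ hθ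
    obtain ⟨θ', hθ', hclose⟩ := hT θ hθ
    have hθ'Z : rootLikelihoodRatio ε κ D θstar θ' ≤ Z :=
      Finset.single_le_sum (f := rootLikelihoodRatio ε κ D θstar)
        (fun θ _ => rootLikelihoodRatio_nonneg ε κ D θstar θ) hθ'
    calc likelihood ε κ D θ ≤ L * likelihood ε κ D θ' := likelihood_le_mul ε κ D hclose
      _ = L * rootLikelihoodRatio ε κ D θstar θ' ^ 2 * likelihood ε κ D θstar := by
          rw [likelihood_eq_sq_rootLikelihoodRatio_mul D θstar θ', mul_assoc]
      _ ≤ L * Z ^ 2 * likelihood ε κ D θstar := by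
          have hpos := likelihood_pos ε κ D θstar
          have hroot := rootLikelihoodRatio_nonneg ε κ D θstar θ'
          gcongr
  refine (Real.sqrt_le_left (by positivity)).2 ?_
  calc posterior ε κ η D A ≤ B * L * (L * Z ^ 2) * n ^ N :=
        hη.posterior_le hn hB hratio D hA (by positivity) hAM
    _ ≤ B * L * (L * Z ^ 2) * (n ^ N) ^ 2 := by
        gcongr
        exact le_self_pow₀ (one_le_pow₀ (by exact_mod_cast hn)) two_ne_zero
    _ = (√B * L * n ^ N * Z) ^ 2 := by
        rw [mul_pow, mul_pow, mul_pow, Real.sq_sqrt hB]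
        ring

theorem IsPriorDensity.lintegral_sqrt_posterior_le {Ω : Type*} [MeasurableSpace Ω]
    {μ : Measure Ω} {X : Ω → Data N n} (hX : Measurable X) (hη : IsPriorDensity η) (hn : 0 < n)
    {B : ℝ} (hB : 0 ≤ B) (hratio : ∀ θ, ∀ θ' ∈ coordBox θstar (1 / n), η θ ≤ B * η θ')
    {A : Set (Simplex N)} (hA : MeasurableSet A) {ρ : ℝ}
    (hρ : ∀ θ ∈ A, ∫⁻ ω, ENNReal.ofReal (rootLikelihoodRatio ε κ (X ω) θstar θ) ∂μ ≤
      ENNReal.ofReal ρ) :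
    ∫⁻ ω, ENNReal.ofReal √(posterior ε κ η (X ω) A) ∂μ ≤
      ENNReal.ofReal (√B * likelihoodConst N ε κ * (n ^ N * ((n + 1) ^ (N + 1) * ρ))) := by
  obtain ⟨T, hTA, hcard, hT⟩ := hη.exists_sqrt_posterior_le (ε := ε) (κ := κ) hn hB hratio hA
  have hL := likelihoodConst_pos N ε κ
  set C := √B * likelihoodConst N ε κ * n ^ N
  have hC : 0 ≤ C := by positivity
  have hmeas : ∀ θ, Measurable fun ω =>
      ENNReal.ofReal (rootLikelihoodRatio ε κ (X ω) θstar θ) := fun θ =>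
    (measurable_of_countable fun D =>
      ENNReal.ofReal (rootLikelihoodRatio ε κ D θstar θ)).comp hX
  have hsum : ∫⁻ ω, ∑ θ ∈ T, ENNReal.ofReal (rootLikelihoodRatio ε κ (X ω) θstar θ) ∂μ ≤
      ENNReal.ofReal ((n + 1) ^ (N + 1) * ρ) := by
    calc ∫⁻ ω, ∑ θ ∈ T, ENNReal.ofReal (rootLikelihoodRatio ε κ (X ω) θstar θ) ∂μ
        ≤ T.card • ENNReal.ofReal ρ := by
          rw [lintegral_finsetSum _ fun θ _ => hmeas θ]
          exact Finset.sum_le_card_nsmul T _ _ fun θ hθ => hρ θ (hTA hθ)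
      _ ≤ ((n + 1) ^ (N + 1)) • ENNReal.ofReal ρ := by gcongr
      _ = ENNReal.ofReal ((n + 1) ^ (N + 1) * ρ) := by
          rw [← ENNReal.ofReal_nsmul, nsmul_eq_mul]
          push_cast
          rfl
  calc ∫⁻ ω, ENNReal.ofReal √(posterior ε κ η (X ω) A) ∂μ
      ≤ ∫⁻ ω, ENNReal.ofReal C *
          ∑ θ ∈ T, ENNReal.ofReal (rootLikelihoodRatio ε κ (X ω) θstar θ) ∂μ := by
        refine lintegral_mono fun ω => ?_
        rw [← ENNReal.ofReal_sum_of_nonneg fun θ _ => rootLikelihoodRatio_nonneg ε κ (X ω) θstar θ,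
          ← ENNReal.ofReal_mul hC]
        exact ENNReal.ofReal_le_ofReal (hT (X ω))
    _ ≤ ENNReal.ofReal C * ENNReal.ofReal ((n + 1) ^ (N + 1) * ρ) := by
        rw [lintegral_const_mul' _ _ ENNReal.ofReal_ne_top]
        exact mul_le_mul_right hsum _
    _ = _ := by rw [← ENNReal.ofReal_mul hC, mul_assoc (√B * likelihoodConst N ε κ)]

theorem tendstoInMeasure_of_tendsto_lintegral_sqrt {α ι : Type*} [MeasurableSpace α]
    {μ : Measure α} {l : Filter ι} {f : ι → α → ℝ} {g : α → ℝ} (hf : ∀ i, AEMeasurable (f i) μ)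
    (hg : AEMeasurable g μ)
    (hfg : Tendsto (fun i => ∫⁻ x, ENNReal.ofReal √|f i x - g x| ∂μ) l (nhds 0)) :
    TendstoInMeasure μ f l g := by
  rw [tendstoInMeasure_iff_norm]
  intro e he
  have hsqrt : ENNReal.ofReal √e ≠ 0 := (ENNReal.ofReal_pos.2 (Real.sqrt_pos.2 he)).ne'
  have hdiv := ENNReal.Tendsto.div_const hfg (Or.inr hsqrt)
  rw [ENNReal.zero_div] at hdiv
  refine tendsto_of_tendsto_of_tendsto_of_le_of_le tendsto_const_nhds hdiv (fun i => zero_le)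
    fun i => ?_
  calc μ {x | e ≤ ‖f i x - g x‖} ≤ μ {x | ENNReal.ofReal √e ≤ ENNReal.ofReal √|f i x - g x|} :=
        measure_mono fun x hx => ENNReal.ofReal_le_ofReal (Real.sqrt_le_sqrt hx)
    _ ≤ (∫⁻ x, ENNReal.ofReal √|f i x - g x| ∂μ) / ENNReal.ofReal √e :=
        meas_ge_le_lintegral_div (((hf i).sub hg).abs.sqrt.ennreal_ofReal) hsqrt
          ENNReal.ofReal_ne_top

theorem tendsto_pow_mul_exp_neg_mul_rpow (k : ℕ) {δ b : ℝ} (hδ : 0 < δ) (hb : 0 < b) :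
    Tendsto (fun n : ℕ => (n : ℝ) ^ k * Real.exp (-(δ * (n : ℝ) ^ b))) atTop (nhds 0) := by
  have hpow : Tendsto (fun n : ℕ => (n : ℝ) ^ b) atTop atTop :=
    (tendsto_rpow_atTop hb).comp tendsto_natCast_atTop_atTop
  refine ((tendsto_rpow_mul_exp_neg_mul_atTop_nhds_zero (k / b) δ hδ).comp hpow).congr fun n => ?_
  rw [Function.comp_apply, ← Real.rpow_mul (Nat.cast_nonneg n), mul_div_cancel₀ _ hb.ne',
    Real.rpow_natCast, neg_mul]

theorem tendsto_pow_mul_succ_pow_mul_exp (p q : ℕ) {δ a : ℝ} (hδ : 0 < δ) (ha : a < 1) :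
    Tendsto (fun n : ℕ => (n : ℝ) ^ p * ((n + 1) ^ q * Real.exp (-(n * (δ * (n : ℝ) ^ (-a))))))
      atTop (nhds 0) := by
  have hlim := (tendsto_pow_mul_exp_neg_mul_rpow (p + q) hδ (sub_pos.2 ha)).const_mul (2 ^ q)
  rw [mul_zero] at hlim
  refine squeeze_zero' (Eventually.of_forall fun n => by positivity) ?_ hlim
  filter_upwards [eventually_ge_atTop 1] with n hn
  have hn' : (1 : ℝ) ≤ n := by exact_mod_cast hn
  have hexp : (n : ℝ) * (δ * (n : ℝ) ^ (-a)) = δ * (n : ℝ) ^ (1 - a) := by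
    rw [sub_eq_add_neg, Real.rpow_add (by positivity), Real.rpow_one]
    ring
  calc (n : ℝ) ^ p * ((n + 1) ^ q * Real.exp (-(n * (δ * (n : ℝ) ^ (-a)))))
      ≤ (n : ℝ) ^ p * ((2 * n) ^ q * Real.exp (-(n * (δ * (n : ℝ) ^ (-a))))) := by
        gcongr
        linarith
    _ = 2 ^ q * ((n : ℝ) ^ (p + q) * Real.exp (-(δ * (n : ℝ) ^ (1 - a)))) := by
        rw [hexp, mul_pow, pow_add]
        ring

theorem measurable_data (n : ℕ) : Measurable (data (N := N) n) := by
  unfold data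
  fun_prop

end AdOBEst

theorem mainTheorem1_general {N : ℕ} {ε κ : ℝ} (hε : ε ≠ 0) (hκ₀ : κ ≠ 0) (hκ₁ : κ < 1)
    (θstar θinit : AdOBEst.Simplex N) {η : AdOBEst.Simplex N → ℝ}
    (hη : AdOBEst.IsPriorDensity η) (hratio : AdOBEst.PriorRatioBounded η θstar)
    {sel : AdOBEst.Simplex N → AdOBEst.ProperSubset N} (hsel : Measurable sel)
    (Q : (n : ℕ) → Kernel (AdOBEst.Data N n × AdOBEst.Simplex N) (AdOBEst.Simplex N))
    [∀ n, IsMarkovKernel (Q n)] {a c : ℝ} (ha : a < 1) (hc : 0 < c) :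
    TendstoInMeasure (AdOBEst.law ε κ θstar θinit sel hsel Q)
      (fun (n : ℕ) ω => AdOBEst.posterior ε κ η (AdOBEst.data n ω)
        {θ | ‖θ.1 - θstar.1‖ ^ 2 ≤ c * (n : ℝ) ^ (-a)})
      atTop (fun _ => (1 : ℝ)) := by
  obtain ⟨δ, hδ, hdecay⟩ := AdOBEst.exists_lintegral_rootLikelihoodRatio_le (N := N) hε hκ₀ hκ₁
  obtain ⟨B, hB, hbound⟩ := hratio.eventually_le_mul
  have hball : ∀ n : ℕ, MeasurableSet
      {θ : AdOBEst.Simplex N | ‖θ.1 - θstar.1‖ ^ 2 ≤ c * (n : ℝ) ^ (-a)} := fun n =>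
    measurableSet_le (by fun_prop) measurable_const
  have hlim := ENNReal.tendsto_ofReal ((AdOBEst.tendsto_pow_mul_succ_pow_mul_exp N (N + 1)
    (mul_pos hδ hc) ha).const_mul (√B * AdOBEst.likelihoodConst N ε κ))
  rw [mul_zero, ENNReal.ofReal_zero] at hlim
  refine AdOBEst.tendstoInMeasure_of_tendsto_lintegral_sqrt (fun n => ?_) aemeasurable_const ?_
  · exact ((measurable_of_countable fun D => AdOBEst.posterior ε κ η D _).comp
      (AdOBEst.measurable_data n)).aemeasurable
  refine tendsto_of_tendsto_of_tendsto_of_le_of_le' tendsto_const_nhds hlim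
    (Eventually.of_forall fun n => zero_le) ?_
  filter_upwards [hbound, eventually_gt_atTop 0] with n hbound hn
  simp_rw [hη.abs_posterior_sub_one _ (hball n)]
  refine hη.lintegral_sqrt_posterior_le (AdOBEst.measurable_data n) hn hB.le hbound
    (hball n).compl fun θ hθ => (hdecay θstar θinit sel hsel Q θ n).trans ?_
  rw [Set.mem_compl_iff, Set.mem_ofPred_eq, not_le] at hθ
  rw [mul_assoc δ]
  gcongr

theorem mainTheorem1 (N : ℕ) (ε κ : ℝ) (hε : 0 < ε) (hκ₀ : 0 < κ) (hκ₁ : κ < 1) :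
    ∃ c : ℝ, 0 < c ∧
      ∀ (θstar θinit : AdOBEst.Simplex N) (η : AdOBEst.Simplex N → ℝ),
        AdOBEst.IsPriorDensity η →
        AdOBEst.PriorRatioBounded η θstar →
      ∀ (U : AdOBEst.Simplex N → AdOBEst.ProperSubset N → ℝ → ℝ)
        (sel : AdOBEst.Simplex N → AdOBEst.ProperSubset N) (hsel : Measurable sel),
        AdOBEst.IsBestSubsetRule U ε sel →
      ∀ (Q : (n : ℕ) → ProbabilityTheory.Kernel
            (AdOBEst.Data N n × AdOBEst.Simplex N) (AdOBEst.Simplex N))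
        [∀ n, ProbabilityTheory.IsMarkovKernel (Q n)] (a : ℝ), 0 < a → a < 1 →
        MeasureTheory.TendstoInMeasure (AdOBEst.law ε κ θstar θinit sel hsel Q)
          (fun (n : ℕ) ω => AdOBEst.posterior ε κ η (AdOBEst.data n ω)
            {θ | ‖θ.1 - θstar.1‖ ^ 2 ≤ c * (n : ℝ) ^ (-a)})
          Filter.atTop (fun _ => (1 : ℝ)) :=
  ⟨1, one_pos, fun θstar θinit _ hη hratio _ _ hsel _ Q _ _ _ ha =>
    mainTheorem1_general hε.ne' hκ₀.ne' hκ₁ θstar θinit hη hratio hsel Q ha one_pos⟩
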